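/- Let $n\ge 1$ and let $\Omega\subset\mathbb{R}^n$ be open. A \emph{comparison flow} in $\Omega$ on $[a,b]$ ($0\le a\le b$) is a family $(B_t)_{t\in[a,b]}$ of open sets whose closures $\overline{B_t}$ are compact subsets of $\Omega$, with smooth boundary (near each of its boundary points, $B_t$ is the set $\{\varphi<0\}$ for a smooth function $\varphi$ with nonvanishing differential at that point), such that $(\partial B_t)_{t\in[a,b]}$ is a classical solution of mean curvature flow: there are a closed $(n-1)$-dimensional manifold $M$ and a smooth map $X\colon M\times[a,b]\to\mathbb{R}^n$ such that every $X(\cdot,t)$ is an immersion with $X(M,t)=\partial B_t$ and $\frac{d}{dt}X(p,t)=\vec H(p,t)$, where $\vec H(\cdot,t)$ is the mean curvature vector of $X(\cdot,t)$; and $B_t$ stays on the same side of its moving boundary (a point enters or leaves $B_t$ only when $\partial B_t$ passes through it). A family $(A_t)_{t\in[0,\infty)}$ of (relatively) open subsets of $\overline\Omega$ is a \emph{supersolution} if for all $0\le a\le b$ and every comparison flow $(B_t)_{t\in[a,b]}$ in $\Omega$, $\overline{B_a}\subset A_a$ implies $B_b\subset A_b$; it is a \emph{subsolution} if $(\overline\Omega\setminus\overline{A_t})_{t\in[0,\infty)}$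 is a supersolution; it is a \emph{weak solution} of mean curvature flow if it is both. Proposition. For every open set $A\subset\Omega$ there is a weak solution $(A_t)_{t\in[0,\infty)}$ of mean curvature flow with $A_0=A$. Moreover there is a smallest such weak solution: one can choose $(A_t)$ so that for every weak solution $(A'_t)_{t\in[0,\infty)}$ with $A\subset A'_0$ one has $A_t\subset A'_t$ for all $t\in[0,\infty)$. -/

import Mathlib

open Set Topology
open scoped ContDiff Manifold InnerProductSpace

noncomputable section

namespace ShadowFlow

/-- The ambient Euclidean space `ℝ^(m+1)`, in which hypersurfaces have dimension `m`. -/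
abbrev Space (m : ℕ) : Type := EuclideanSpace ℝ (Fin (m + 1))

/-- The parameter space `ℝ^m`. -/
abbrev Param (m : ℕ) : Type := EuclideanSpace ℝ (Fin m)

/-- The coordinate vector `e_i` of the parameter space. -/
def coordVec {m : ℕ} (i : Fin m) : Param m := EuclideanSpace.single i 1

/-- The first fundamental form `g_ij = ⟨∂_i F, ∂_j F⟩` of `F : ℝ^m → ℝ^(m+1)` at `u`. -/
def firstFundamentalForm {m : ℕ} (F : Param m → Space m) (u : Param m) :
    Matrix (Fin m) (Fin m) ℝ :=
  fun i j => ⟪fderiv ℝ F u (coordVec i), fderiv ℝ F u (coordVec j)⟫_ℝ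

/-- The vector-valued second fundamental form: `(∂_i ∂_j F)^⊥`, the component of the second
derivative that is orthogonal to the tangent space. -/
def secondFundamentalForm {m : ℕ} (F : Param m → Space m) (u : Param m) (i j : Fin m) :
    Space m :=
  (LinearMap.range (fderiv ℝ F u).toLinearMap)ᗮ.starProjection
    (fderiv ℝ (fderiv ℝ F) u (coordVec i) (coordVec j))

/-- The mean curvature vector `g^{ij} (∂_i ∂_j F)^⊥` (that is, `-H ν`) of a local
parametrization `F` at `u`. -/
def localMeanCurvatureVector {m : ℕ} (F : Param m → Space m) (u : Param m) : Space m :=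
  ∑ i, ∑ j, (firstFundamentalForm F u)⁻¹ i j • secondFundamentalForm F u i j

/-- The mean curvature vector of an immersion `f : M → ℝ^(m+1)` at `p`, computed in the
preferred chart at `p` (it does not depend on the chart). -/
def meanCurvatureVector {m : ℕ} {M : Type} [TopologicalSpace M] [ChartedSpace (Param m) M]
    (f : M → Space m) (p : M) : Space m :=
  localMeanCurvatureVector (f ∘ (extChartAt (𝓡 m) p).symm) (extChartAt (𝓡 m) p p)

/-- `(S t)`, `t ∈ [a,b]`, is a classical (smooth) mean curvature flow of closed hypersurfaces:
there are a closed `m`-manifold `M` and a map `X`, smooth on `M × [a,b]`, such that every `X t`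
is an immersion with image `S t` and `d/dt X` is the mean curvature vector. -/
def IsClassicalMCF {m : ℕ} (a b : ℝ) (S : ℝ → Set (Space m)) : Prop :=
  ∃ (M : Type) (_ : TopologicalSpace M) (_ : ChartedSpace (Param m) M)
    (_ : IsManifold (𝓡 m) ∞ M) (_ : T2Space M) (_ : CompactSpace M) (X : ℝ → M → Space m),
    ContMDiffOn ((𝓡 m).prod 𝓘(ℝ, ℝ)) 𝓘(ℝ, Space m) ∞
        (fun q : M × ℝ => X q.2 q.1) (univ ×ˢ Icc a b) ∧
      ∀ t ∈ Icc a b, range (X t) = S t ∧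
        ∀ p : M, Function.Injective (mfderiv (𝓡 m) 𝓘(ℝ, Space m) (X t) p) ∧
          HasDerivWithinAt (fun s => X s p) (meanCurvatureVector (X t) p) (Icc a b) t

/-- `∂B ∈ C^∞`: near each of its boundary points, `B` is the sublevel set `{φ < 0}` of a smooth
function with nonvanishing differential at that point. -/
def HasSmoothBoundary {m : ℕ} (B : Set (Space m)) : Prop :=
  ∀ x ∈ frontier B, ∃ φ : Space m → ℝ, ContDiff ℝ ∞ φ ∧ fderiv ℝ φ x ≠ 0 ∧
    ∀ᶠ y in 𝓝 x, (y ∈ B ↔ φ y < 0)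

/-- The families `(B t)`, `t ∈ [a,b]`, of open sets used for comparison: `B t` is compactly
contained in `Ω`, has smooth boundary, and the boundaries are a classical mean curvature flow.
The field `side` says that `B t` stays on the same side of its moving boundary: a point enters
or leaves `B t` only when the boundary passes through it. -/
structure IsComparisonFlow {m : ℕ} (Ω : Set (Space m)) (a b : ℝ) (B : ℝ → Set (Space m)) :
    Prop where
  isOpen : ∀ t ∈ Icc a b, IsOpen (B t)
  isCompact_closure : ∀ t ∈ Icc a b, IsCompact (closure (B t))
  closure_subset : ∀ t ∈ Icc a b, closure (B t) ⊆ Ω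
  smooth : ∀ t ∈ Icc a b, HasSmoothBoundary (B t)
  flow : IsClassicalMCF a b (fun t => frontier (B t))
  side : ∀ s ∈ Icc a b, ∀ t ∈ Icc a b, ∀ x, (∀ r ∈ uIcc s t, x ∉ frontier (B r)) →
    (x ∈ B s ↔ x ∈ B t)

/-- `A` is an open subset of `closure Ω` (in the relative topology). -/
def IsOpenIn {m : ℕ} (Ω A : Set (Space m)) : Prop :=
  ∃ U : Set (Space m), IsOpen U ∧ A = U ∩ closure Ω

/-- Supersolutions `(A t)`, `t ∈ [0,∞)`. Only the values at times `t ≥ 0` matter. -/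
def IsSupersolution {m : ℕ} (Ω : Set (Space m)) (A : ℝ → Set (Space m)) : Prop :=
  (∀ t, 0 ≤ t → IsOpenIn Ω (A t)) ∧
    ∀ (a b : ℝ) (B : ℝ → Set (Space m)), 0 ≤ a → a ≤ b → IsComparisonFlow Ω a b B →
      closure (B a) ⊆ A a → B b ⊆ A b

/-- Subsolutions: families of open subsets of `closure Ω` such that the complements of their
closures are a supersolution. -/
def IsSubsolution {m : ℕ} (Ω : Set (Space m)) (A : ℝ → Set (Space m)) : Prop :=
  (∀ t, 0 ≤ t → IsOpenIn Ω (A t)) ∧ IsSupersolution Ω (fun t => closure Ω \ closure (A t))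

/-- Weak solutions of mean curvature flow. -/
def IsWeakSolution {m : ℕ} (Ω : Set (Space m)) (A : ℝ → Set (Space m)) : Prop :=
  IsSupersolution Ω A ∧ IsSubsolution Ω A

end ShadowFlow

end

namespace ShadowFlow

/-! ### The second-order condition at a minimum of the distance -/

section SecondOrder

/-! The weak solution comes from Perron's method. Intersect all supersolutions containing `A`
initially and take relative interiors: comparison sets are open, so the result is again a
supersolution, and it is the smallest one. If it were not a subsolution, some comparison flow
starting away from its closure would run into it. By `IsSupersolution.diff_comparisonFlow`, cutting
that flow out leaves a supersolution that still contains `A` initially, which contradicts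
minimality.

Cutting out is permitted by the avoidance principle `IsComparisonFlow.disjoint`, the only geometric
input. At a closest pair of points of two hypersurfaces the second variation of the distance
compares the mean curvatures (`inner_meanCurvature_sub_nonneg`), so the squared distance has
nonnegative time derivative there, and `pos_of_deriv_nonneg_at_min` keeps disjoint boundaries
disjoint. Connectedness of the time interval then passes from the boundaries to the regions. -/

lemma IsLocalMin.deriv_deriv_nonneg {f : ℝ → ℝ} {x : ℝ} (h : IsLocalMin f x)
    (hc : ContinuousAt f x) : 0 ≤ deriv (deriv f) x := by
  by_contra! hneg
  have hmax : IsLocalMax f x := isLocalMax_of_deriv_deriv_neg hneg h.deriv_eq_zero hc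
  have hconst : f =ᶠ[𝓝 x] fun _ => f x := by
    filter_upwards [h, hmax] with y h₁ h₂ using le_antisymm h₂ h₁
  have h0 : deriv (deriv f) x = 0 := by
    rw [hconst.deriv.deriv_eq]
    simp
  exact hneg.ne h0

variable {E : Type*} [NormedAddCommGroup E] [InnerProductSpace ℝ E]

/-- Second variation of `‖c‖²` at a local minimum along a curve. -/
lemma second_variation_nonneg {c c' : ℝ → E} {c'' : E} {x : ℝ}
    (h₁ : ∀ᶠ s in 𝓝 x, HasDerivAt c (c' s) s) (h₂ : HasDerivAt c' c'' x)
    (hmin : IsLocalMin (fun s => ‖c s‖ ^ 2) x) :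
    0 ≤ ⟪c x, c''⟫_ℝ + ⟪c' x, c' x⟫_ℝ := by
  have hd : deriv (fun s => ‖c s‖ ^ 2) =ᶠ[𝓝 x] fun s => 2 * ⟪c s, c' s⟫_ℝ := by
    filter_upwards [h₁] with s hs using hs.norm_sq.deriv
  have hdd : deriv (deriv (fun s => ‖c s‖ ^ 2)) x = 2 * (⟪c x, c''⟫_ℝ + ⟪c' x, c' x⟫_ℝ) := by
    rw [hd.deriv_eq]
    exact ((h₁.self_of_nhds.inner ℝ h₂).const_mul 2).deriv
  have := IsLocalMin.deriv_deriv_nonneg hmin h₁.self_of_nhds.norm_sq.continuousAt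
  rw [hdd] at this
  linarith

lemma hasDerivAt_along_line {V W : Type*} [NormedAddCommGroup V] [NormedSpace ℝ V]
    [NormedAddCommGroup W] [NormedSpace ℝ W] {H : V → W} {z : V} (hH : ContDiffAt ℝ 2 H z)
    (d : V) :
    (∀ᶠ s : ℝ in 𝓝 0, HasDerivAt (fun s : ℝ => H (z + s • d)) (fderiv ℝ H (z + s • d) d) s) ∧
      HasDerivAt (fun s : ℝ => fderiv ℝ H (z + s • d) d) (fderiv ℝ (fderiv ℝ H) z d d) 0 := by
  have hline : ∀ s : ℝ, HasDerivAt (fun s : ℝ => z + s • d) d s := fun s => by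
    simpa using ((hasDerivAt_id s).smul_const d).const_add z
  constructor
  · have hev : ∀ᶠ z' in 𝓝 z, ContDiffAt ℝ 2 H z' := hH.eventually (by simp)
    have hc : Filter.Tendsto (fun s : ℝ => z + s • d) (𝓝 0) (𝓝 z) := by
      simpa using (hline 0).continuousAt.tendsto
    filter_upwards [hc.eventually hev] with s hs
    exact (hs.differentiableAt (by simp)).hasFDerivAt.comp_hasDerivAt s (hline s)
  · have hH' : ContDiffAt ℝ 1 (fderiv ℝ H) z := hH.fderiv_right (by norm_num)
    have h1 : HasFDerivAt (fderiv ℝ H) (fderiv ℝ (fderiv ℝ H) z) (z + (0 : ℝ) • d) := by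
      simpa using (hH'.differentiableAt (by simp)).hasFDerivAt
    have h2 : HasDerivAt (fun s : ℝ => fderiv ℝ H (z + s • d)) (fderiv ℝ (fderiv ℝ H) z d) 0 :=
      h1.comp_hasDerivAt (0 : ℝ) (hline 0)
    exact (ContinuousLinearMap.apply ℝ W d).hasFDerivAt.comp_hasDerivAt (0 : ℝ) h2

end SecondOrder

section Local

variable {m : ℕ}

/-- If `D` maps the vectors `u k` to an orthonormal family, the inverse of the Gram matrix of `D`
is `∑ k, u k ⊗ u k`. -/
lemma gram_inv_apply {D : Param m →L[ℝ] Space m} {u : Fin m → Param m}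
    (hu : Orthonormal ℝ fun k => D (u k)) (i j : Fin m) :
    (Matrix.of fun i j => ⟪D (coordVec i), D (coordVec j)⟫_ℝ)⁻¹ i j = ∑ k, u k i * u k j := by
  set g : Matrix (Fin m) (Fin m) ℝ := Matrix.of fun i j => ⟪D (coordVec i), D (coordVec j)⟫_ℝ
  set P : Matrix (Fin m) (Fin m) ℝ := Matrix.of fun k i => u k i
  have hexp : ∀ k, D (u k) = ∑ i, u k i • D (coordVec i) := by
    intro k
    conv_lhs => rw [← (EuclideanSpace.basisFun (Fin m) ℝ).sum_repr (u k)]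
    simp [coordVec]
  have h1 : P * (g * P.transpose) = 1 := by
    ext k l
    have := orthonormal_iff_ite.1 hu k l
    rw [Matrix.one_apply, ← this, hexp k, hexp l]
    simp only [Matrix.mul_apply, sum_inner, inner_sum, inner_smul_left, inner_smul_right, P, g,
      Matrix.of_apply, Matrix.transpose_apply, Finset.mul_sum]
    rw [Finset.sum_comm]
    refine Finset.sum_congr rfl fun i _ => Finset.sum_congr rfl fun j _ => ?_
    simp only [conj_trivial]
    ring
  have h2 : g * (P.transpose * P) = 1 := by
    rw [← Matrix.mul_assoc]
    -- For square matrices a one-sided inverse is two-sided, so the factor `P` may be moved to the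
    -- other end.
    exact mul_eq_one_comm.1 h1
  rw [Matrix.inv_eq_right_inv h2]
  simp [Matrix.mul_apply, P]

/-- The normal component of the mean curvature vector, computed in an orthonormal frame. -/
lemma inner_localMeanCurvatureVector {F : Param m → Space m} {x : Param m} {w : Space m}
    (hw : ∀ ξ, ⟪fderiv ℝ F x ξ, w⟫_ℝ = 0) {u : Fin m → Param m}
    (hu : Orthonormal ℝ fun k => fderiv ℝ F x (u k)) :
    ⟪w, localMeanCurvatureVector F x⟫_ℝ =
      ∑ k, ⟪w, fderiv ℝ (fderiv ℝ F) x (u k) (u k)⟫_ℝ := by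
  have hwmem : w ∈ (LinearMap.range (fderiv ℝ F x).toLinearMap)ᗮ := by
    rw [Submodule.mem_orthogonal]
    rintro _ ⟨ξ, rfl⟩
    exact hw ξ
  have hII : ∀ i j, ⟪w, secondFundamentalForm F x i j⟫_ℝ =
      ⟪w, fderiv ℝ (fderiv ℝ F) x (coordVec i) (coordVec j)⟫_ℝ := by
    intro i j
    rw [secondFundamentalForm, ← Submodule.inner_starProjection_left_eq_right,
      Submodule.starProjection_eq_self_iff.2 hwmem]
  have hexp : ∀ k, u k = ∑ i, u k i • coordVec i := by
    intro k
    conv_lhs => rw [← (EuclideanSpace.basisFun (Fin m) ℝ).sum_repr (u k)]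
    simp [coordVec]
  have hterm : ∀ k, ⟪w, fderiv ℝ (fderiv ℝ F) x (u k) (u k)⟫_ℝ =
      ∑ i, ∑ j, (u k i * u k j) * ⟪w, fderiv ℝ (fderiv ℝ F) x (coordVec i) (coordVec j)⟫_ℝ := by
    intro k
    conv_lhs => rw [hexp k]
    simp only [map_sum, map_smul, _root_.sum_apply, _root_.smul_apply,
      inner_sum, inner_smul_right, Finset.smul_sum]
    rw [Finset.sum_comm]
    refine Finset.sum_congr rfl fun i _ => Finset.sum_congr rfl fun j _ => ?_
    ring
  have hg : ∀ i j, (firstFundamentalForm F x)⁻¹ i j = ∑ k, u k i * u k j := gram_inv_apply hu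
  simp only [localMeanCurvatureVector, inner_sum, inner_smul_right, hII, hterm, hg,
    Finset.sum_mul]
  rw [Finset.sum_comm]
  refine (Finset.sum_congr rfl fun i _ => Finset.sum_comm).trans ?_
  exact Finset.sum_comm.trans (Finset.sum_congr rfl fun k _ => Finset.sum_comm)

/-- The range of an injective linear map `ℝ^m → ℝ^(m+1)` orthogonal to `w ≠ 0` is `wᗮ`. -/
lemma range_eq_orthogonal {D : Param m →L[ℝ] Space m} (hD : Function.Injective D)
    {w : Space m} (hw0 : w ≠ 0) (hw : ∀ ξ, ⟪D ξ, w⟫_ℝ = 0) :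
    LinearMap.range D.toLinearMap = (ℝ ∙ w)ᗮ := by
  have : Fact (Module.finrank ℝ (Space m) = m + 1) := ⟨by simp⟩
  refine Submodule.eq_of_le_of_finrank_eq ?_ ?_
  · rintro _ ⟨ξ, rfl⟩
    rw [Submodule.mem_orthogonal_singleton_iff_inner_left]
    exact hw ξ
  · rw [LinearMap.finrank_range_of_inj hD, Submodule.finrank_orthogonal_span_singleton (n := m) hw0]
    simp

/-- At a minimum of the distance between two immersed hypersurfaces the difference of the mean
curvature vectors does not point inwards. -/
lemma inner_meanCurvature_sub_nonneg {F G : Param m → Space m} {x y : Param m}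
    (hF : ContDiffAt ℝ 2 F x) (hG : ContDiffAt ℝ 2 G y)
    (hFi : Function.Injective (fderiv ℝ F x)) (hGi : Function.Injective (fderiv ℝ G y))
    (hmin : ∀ x' y', ‖F x - G y‖ ^ 2 ≤ ‖F x' - G y'‖ ^ 2) :
    0 ≤ ⟪F x - G y, localMeanCurvatureVector F x - localMeanCurvatureVector G y⟫_ℝ := by
  set w := F x - G y with hwdef
  rcases eq_or_ne w 0 with hw0 | hw0
  · simp [hw0]
  have hFd : HasFDerivAt F (fderiv ℝ F x) x := (hF.differentiableAt (by simp)).hasFDerivAt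
  have hGd : HasFDerivAt G (fderiv ℝ G y) y := (hG.differentiableAt (by simp)).hasFDerivAt
  have hwF : ∀ ξ, ⟪fderiv ℝ F x ξ, w⟫_ℝ = 0 := by
    have hl : IsLocalMin (fun x' => ‖F x' - G y‖ ^ 2) x :=
      Filter.Eventually.of_forall fun x' => hmin x' y
    have h0 := hl.hasFDerivAt_eq_zero (hFd.sub_const (G y)).norm_sq
    intro ξ
    have := congrArg (fun L => L ξ) h0
    simpa [real_inner_comm, ← hwdef] using this
  have hwG : ∀ ξ, ⟪fderiv ℝ G y ξ, w⟫_ℝ = 0 := by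
    have hl : IsLocalMin (fun y' => ‖F x - G y'‖ ^ 2) y :=
      Filter.Eventually.of_forall fun y' => hmin x y'
    have h0 := hl.hasFDerivAt_eq_zero (hGd.const_sub (F x)).norm_sq
    intro ξ
    have := congrArg (fun L => L ξ) h0
    simpa [real_inner_comm, ← hwdef] using this
  have : Fact (Module.finrank ℝ (Space m) = m + 1) := ⟨by simp⟩
  -- Both tangent spaces equal `wᗮ`, so one orthonormal frame serves both surfaces.
  let τ := OrthonormalBasis.fromOrthogonalSpanSingleton (𝕜 := ℝ) m hw0
  have hτ : Orthonormal ℝ fun k => (τ k : Space m) :=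
    τ.orthonormal.comp_linearIsometry (ℝ ∙ w)ᗮ.subtypeₗᵢ
  have hu : ∀ k, ∃ u, fderiv ℝ F x u = τ k := fun k =>
    (range_eq_orthogonal hFi hw0 hwF).ge (τ k).2
  have hv : ∀ k, ∃ v, fderiv ℝ G y v = τ k := fun k =>
    (range_eq_orthogonal hGi hw0 hwG).ge (τ k).2
  choose u hu using hu
  choose v hv using hv
  rw [inner_sub_right, inner_localMeanCurvatureVector hwF (u := u) (by simpa only [hu] using hτ),
    inner_localMeanCurvatureVector hwG (u := v) (by simpa only [hv] using hτ),
    ← Finset.sum_sub_distrib]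
  refine Finset.sum_nonneg fun k _ => ?_
  rw [← inner_sub_right]
  obtain ⟨hF1, hF2⟩ := hasDerivAt_along_line hF (u k)
  obtain ⟨hG1, hG2⟩ := hasDerivAt_along_line hG (v k)
  -- Both points move with the same initial velocity `τ k`. Hence `c' 0 = 0`, and only the second
  -- derivatives survive in the second variation.
  have key := second_variation_nonneg (x := 0)
    (c := fun s : ℝ => F (x + s • u k) - G (y + s • v k))
    (c' := fun s : ℝ => fderiv ℝ F (x + s • u k) (u k) - fderiv ℝ G (y + s • v k) (v k))
    (by filter_upwards [hF1, hG1] with s h1 h2 using h1.sub h2) (hF2.sub hG2)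
    (Filter.Eventually.of_forall fun s => by simpa using hmin _ _)
  simpa [hu, hv] using key

end Local

/-! ### Two classical flows that are disjoint initially stay disjoint -/

section Manifold

variable {m : ℕ} {M : Type} [TopologicalSpace M] [ChartedSpace (Param m) M]

lemma contDiffAt_comp_extChartAt_symm [IsManifold (𝓡 m) ∞ M] {f : M → Space m}
    (hf : ContMDiff (𝓡 m) 𝓘(ℝ, Space m) ∞ f) (p : M) :
    ContDiffAt ℝ 2 (f ∘ (extChartAt (𝓡 m) p).symm) (extChartAt (𝓡 m) p p) := by
  have h := (contMDiffAt_iff.1 (hf p)).2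
  rw [ModelWithCorners.range_eq_univ, contDiffWithinAt_univ] at h
  exact h.of_le (by norm_cast)

lemma fderiv_comp_extChartAt_symm_injective [IsManifold (𝓡 m) ∞ M] {f : M → Space m}
    (hf : ContMDiff (𝓡 m) 𝓘(ℝ, Space m) ∞ f) {p : M}
    (h : Function.Injective (mfderiv (𝓡 m) 𝓘(ℝ, Space m) f p)) :
    Function.Injective
      (fderiv ℝ (f ∘ (extChartAt (𝓡 m) p).symm) (extChartAt (𝓡 m) p p)) := by
  have hd : MDifferentiableAt (𝓡 m) 𝓘(ℝ, Space m) f p := (hf p).mdifferentiableAt (by simp)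
  rw [hd.mfderiv] at h
  rw [ModelWithCorners.range_eq_univ, fderivWithin_univ] at h
  exact h

lemma contMDiff_slice {a b t : ℝ} {X : ℝ → M → Space m}
    (hX : ContMDiffOn ((𝓡 m).prod 𝓘(ℝ, ℝ)) 𝓘(ℝ, Space m) ∞
      (fun q : M × ℝ => X q.2 q.1) (univ ×ˢ Icc a b)) (ht : t ∈ Icc a b) :
    ContMDiff (𝓡 m) 𝓘(ℝ, Space m) ∞ (X t) := by
  have h : ContMDiff (𝓡 m) ((𝓡 m).prod 𝓘(ℝ, ℝ)) ∞ (fun p : M => (p, t)) :=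
    contMDiff_id.prodMk contMDiff_const
  exact hX.comp_contMDiff h fun p => ⟨mem_univ _, ht⟩

variable {N : Type} [TopologicalSpace N] [ChartedSpace (Param m) N]

lemma inner_meanCurvatureVector_sub_nonneg [IsManifold (𝓡 m) ∞ M] [IsManifold (𝓡 m) ∞ N]
    {f : M → Space m} {g : N → Space m} {p : M} {q : N}
    (hf : ContMDiff (𝓡 m) 𝓘(ℝ, Space m) ∞ f) (hg : ContMDiff (𝓡 m) 𝓘(ℝ, Space m) ∞ g)
    (hfi : Function.Injective (mfderiv (𝓡 m) 𝓘(ℝ, Space m) f p))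
    (hgi : Function.Injective (mfderiv (𝓡 m) 𝓘(ℝ, Space m) g q))
    (hmin : ∀ p' q', ‖f p - g q‖ ^ 2 ≤ ‖f p' - g q'‖ ^ 2) :
    0 ≤ ⟪f p - g q, meanCurvatureVector f p - meanCurvatureVector g q⟫_ℝ := by
  have hp : (f ∘ (extChartAt (𝓡 m) p).symm) (extChartAt (𝓡 m) p p) = f p :=
    congrArg f (extChartAt_to_inv p)
  have hq : (g ∘ (extChartAt (𝓡 m) q).symm) (extChartAt (𝓡 m) q q) = g q :=
    congrArg g (extChartAt_to_inv q)
  have := inner_meanCurvature_sub_nonneg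
    (contDiffAt_comp_extChartAt_symm hf p) (contDiffAt_comp_extChartAt_symm hg q)
    (fderiv_comp_extChartAt_symm_injective hf hfi) (fderiv_comp_extChartAt_symm_injective hg hgi)
    -- The inverse charts are total functions into `M` and `N`, so global minimality transfers even
    -- at parameters outside the chart targets.
    (fun x' y' => by rw [hp, hq]; exact hmin _ _)
  rwa [hp, hq] at this

end Manifold

/-- Since `a < t`, one may move to the left of `t` inside the interval, and the direction `a - t`
lies in the tangent cone there. -/
lemma nonpos_deriv_of_min_right_end {f : ℝ → ℝ} {f' a b t : ℝ} (hat : a < t) (htb : t ≤ b)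
    (hf : HasDerivWithinAt f f' (Icc a b) t) (hmin : ∀ s ∈ Icc a b, f t ≤ f s) : f' ≤ 0 := by
  have hl : IsLocalMinOn f (Icc a b) t :=
    Filter.eventually_of_mem self_mem_nhdsWithin hmin
  have hcone : a - t ∈ posTangentConeAt (Icc a b) t :=
    sub_mem_posTangentConeAt_of_segment_subset <| by
      rw [segment_symm, segment_eq_Icc hat.le]
      exact Icc_subset_Icc_right htb
  have h0 := hl.hasFDerivWithinAt_nonneg hf.hasFDerivWithinAt hcone
  simp at h0
  nlinarith

/-- A minimum principle: a function on `K × [a,b]`, `K` compact, that is positive at time `a` and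
whose time derivative is nonnegative at every spatial minimum remains positive. -/
lemma pos_of_deriv_nonneg_at_min {K : Type*} [TopologicalSpace K] [CompactSpace K]
    {g : K → ℝ → ℝ} {a b : ℝ}
    (hg : ContinuousOn (fun z : K × ℝ => g z.1 z.2) (univ ×ˢ Icc a b))
    (hd : ∀ k, ∀ r ∈ Icc a b, (∀ k', g k r ≤ g k' r) →
      ∃ d, 0 ≤ d ∧ HasDerivWithinAt (g k) d (Icc a b) r)
    (h0 : ∀ k, 0 < g k a) (k₀ : K) {t : ℝ} (ht : t ∈ Icc a b) : 0 < g k₀ t := by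
  by_contra! hneg
  have ha : a ∈ Icc a b := ⟨le_rfl, ht.1.trans ht.2⟩
  have hga : Continuous fun k => g k a :=
    hg.comp_continuous (f := fun k => (k, a)) (by fun_prop) fun k => ⟨mem_univ _, ha⟩
  obtain ⟨k₁, -, hk₁⟩ := isCompact_univ.exists_isMinOn ⟨k₀, mem_univ _⟩ hga.continuousOn
  have hδ0 := h0 k₁
  have hlow : ∀ k, g k₁ a ≤ g k a := fun k => hk₁ (mem_univ k)
  -- Adding `ε * (s - a)` turns the weak inequality `0 ≤ d` into a strict one. The bound on `ε`
  -- keeps the perturbed minimum away from time `a`; the `+ 1` in the denominator covers `t = a`.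
  obtain ⟨ε, hε, hεδ⟩ : ∃ ε > 0, ε * (t - a) < g k₁ a := by
    have := ht.1
    refine ⟨g k₁ a / (t - a + 1), by apply div_pos <;> linarith, ?_⟩
    rw [div_mul_eq_mul_div, div_lt_iff₀ (by linarith)]
    nlinarith
  have hcont : ContinuousOn (fun z : K × ℝ => g z.1 z.2 + ε * (z.2 - a)) (univ ×ˢ Icc a b) :=
    hg.add (Continuous.continuousOn (by fun_prop))
  obtain ⟨⟨k, r⟩, ⟨-, hr⟩, hmin⟩ := (isCompact_univ.prod isCompact_Icc).exists_isMinOn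
    ⟨(k₀, t), mem_univ _, ht⟩ hcont
  replace hr : r ∈ Icc a b := hr
  have hmin' : ∀ k', ∀ s ∈ Icc a b, g k r + ε * (r - a) ≤ g k' s + ε * (s - a) :=
    fun k' s hs => hmin (show (k', s) ∈ univ ×ˢ Icc a b from ⟨mem_univ _, hs⟩)
  have har : a < r := by
    refine lt_of_le_of_ne hr.1 fun h => ?_
    have h1 := hmin' k₀ t ht
    have h2 := hlow k
    rw [← h, sub_self, mul_zero] at h1
    linarith
  obtain ⟨d, hd0, hder⟩ := hd k r hr fun k' => by simpa using hmin' k' r hr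
  have := nonpos_deriv_of_min_right_end har hr.2
    (hder.add (((hasDerivWithinAt_id r (Icc a b)).sub_const a).const_mul ε))
    fun s hs => hmin' k s hs
  linarith

/-- Two classical mean curvature flows of closed hypersurfaces that are disjoint initially remain
disjoint. -/
theorem IsClassicalMCF.disjoint {m : ℕ} {a b : ℝ} {S T : ℝ → Set (Space m)}
    (hS : IsClassicalMCF a b S) (hT : IsClassicalMCF a b T) (h0 : Disjoint (S a) (T a))
    {t : ℝ} (ht : t ∈ Icc a b) : Disjoint (S t) (T t) := by
  obtain ⟨M, _, _, _, _, _, X, hX, hX'⟩ := hS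
  obtain ⟨N, _, _, _, _, _, Y, hY, hY'⟩ := hT
  have ha : a ∈ Icc a b := ⟨le_rfl, ht.1.trans ht.2⟩
  rw [← (hX' t ht).1, ← (hY' t ht).1, Set.disjoint_left]
  rintro _ ⟨p₀, rfl⟩ ⟨q₀, hpq⟩
  rw [← (hX' a ha).1, ← (hY' a ha).1] at h0
  have hne : ∀ p q, X a p ≠ Y a q := fun p q h =>
    Set.disjoint_left.1 h0 (mem_range_self p) (h ▸ mem_range_self q)
  have h1 : ContinuousOn (fun z : (M × N) × ℝ => X z.2 z.1.1) (univ ×ˢ Icc a b) :=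
    hX.continuousOn.comp (f := fun z : (M × N) × ℝ => (z.1.1, z.2))
      (Continuous.continuousOn (by fun_prop)) fun z hz => ⟨mem_univ _, hz.2⟩
  have h2 : ContinuousOn (fun z : (M × N) × ℝ => Y z.2 z.1.2) (univ ×ˢ Icc a b) :=
    hY.continuousOn.comp (f := fun z : (M × N) × ℝ => (z.1.2, z.2))
      (Continuous.continuousOn (by fun_prop)) fun z hz => ⟨mem_univ _, hz.2⟩
  have hpos := pos_of_deriv_nonneg_at_min (K := M × N)
    (g := fun z s => ‖X s z.1 - Y s z.2‖ ^ 2) ((h1.sub h2).norm.pow 2)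
    (fun z r hr hmin => ⟨_, mul_nonneg zero_le_two
      (inner_meanCurvatureVector_sub_nonneg (contMDiff_slice hX hr) (contMDiff_slice hY hr)
        ((hX' r hr).2 z.1).1 ((hY' r hr).2 z.2).1 fun p' q' => hmin (p', q')),
      (((hX' r hr).2 z.1).2.sub ((hY' r hr).2 z.2).2).norm_sq⟩)
    (fun z => by
      have := norm_pos_iff.2 (sub_ne_zero.2 (hne z.1 z.2))
      positivity) (p₀, q₀) ht
  simp [hpq] at hpos

/-! ### The avoidance principle for comparison flows -/

section Avoidance

variable {m : ℕ} {Ω : Set (Space m)} {a b : ℝ} {B C : ℝ → Set (Space m)}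

lemma IsClassicalMCF.mono {S : ℝ → Set (Space m)} (h : IsClassicalMCF a b S) {c d : ℝ}
    (hcd : Icc c d ⊆ Icc a b) : IsClassicalMCF c d S := by
  obtain ⟨M, i₁, i₂, i₃, i₄, i₅, X, hX, hX'⟩ := h
  exact ⟨M, i₁, i₂, i₃, i₄, i₅, X, hX.mono (prod_mono_right hcd), fun t ht =>
    ⟨(hX' t (hcd ht)).1, fun p => ⟨((hX' t (hcd ht)).2 p).1, ((hX' t (hcd ht)).2 p).2.mono hcd⟩⟩⟩

lemma IsComparisonFlow.mono (h : IsComparisonFlow Ω a b B) {c d : ℝ}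
    (hcd : Icc c d ⊆ Icc a b) : IsComparisonFlow Ω c d B where
  isOpen t ht := h.isOpen t (hcd ht)
  isCompact_closure t ht := h.isCompact_closure t (hcd ht)
  closure_subset t ht := h.closure_subset t (hcd ht)
  smooth t ht := h.smooth t (hcd ht)
  flow := h.flow.mono hcd
  side s hs t ht := h.side s (hcd hs) t (hcd ht)

/-- The space-time track of a classical flow is compact. -/
lemma IsClassicalMCF.isCompact_track {S : ℝ → Set (Space m)} (h : IsClassicalMCF a b S) :
    IsCompact {z : Space m × Icc a b | z.1 ∈ S z.2} := by
  obtain ⟨M, _, _, _, _, _, X, hX, hX'⟩ := h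
  have hc : Continuous fun z : M × Icc a b => X z.2 z.1 :=
    hX.continuousOn.comp_continuous (f := fun z : M × Icc a b => (z.1, (z.2 : ℝ)))
      (by fun_prop) fun z => ⟨mem_univ _, z.2.2⟩
  convert isCompact_range (hc.prodMk continuous_snd) using 1
  ext ⟨x, t⟩
  rw [mem_ofPred_eq, ← (hX' t t.2).1]
  constructor
  · rintro ⟨p, rfl⟩
    exact ⟨(p, t), rfl⟩
  · rintro ⟨⟨p, s⟩, h⟩
    obtain ⟨rfl, rfl⟩ := Prod.ext_iff.1 h
    exact ⟨p, rfl⟩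

lemma subset_of_disjoint_frontier {E : Type*} [TopologicalSpace E] {s U : Set E}
    (hs : IsPreconnected s) (hU : IsOpen U) (hd : Disjoint s (frontier U))
    (hne : (s ∩ U).Nonempty) : s ⊆ U := by
  refine hs.subset_left_of_subset_union hU isClosed_closure.isOpen_compl
    (disjoint_compl_right.mono_left subset_closure) (fun x hx => ?_) hne
  have := Set.disjoint_left.1 hd hx
  rw [hU.frontier_eq] at this
  by_cases hxU : x ∈ U
  · exact Or.inl hxU
  · exact Or.inr fun h => this ⟨h, hxU⟩

/-- Away from the moving boundary, membership in a comparison flow is locally constant in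
space-time. -/
lemma IsComparisonFlow.eventually_mem_iff (h : IsComparisonFlow Ω a b B)
    {z : Space m × Icc a b} (hz : z.1 ∉ frontier (B z.2)) :
    ∀ᶠ y in 𝓝 z, (y.1 ∈ B y.2 ↔ z.1 ∈ B z.2) := by
  have hopen : {y : Space m × Icc a b | y.1 ∈ frontier (B y.2)}ᶜ ∈ 𝓝 z :=
    h.flow.isCompact_track.isClosed.isOpen_compl.mem_nhds hz
  obtain ⟨r, hr, hsub⟩ := Metric.mem_nhds_iff.1 hopen
  filter_upwards [Metric.ball_mem_nhds z hr] with y hy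
  rw [← ball_prod_same] at hy hsub
  -- Move in time first, by `side`, and then in space, inside a ball that misses the boundary.
  have h1 : y.1 ∈ B y.2 ↔ y.1 ∈ B z.2 := by
    refine h.side _ y.2.2 _ z.2.2 _ fun s hs => ?_
    have hs' : s ∈ Icc a b := uIcc_subset_Icc y.2.2 z.2.2 hs
    refine hsub (show (y.1, (⟨s, hs'⟩ : Icc a b)) ∈ _ from ⟨hy.1, ?_⟩)
    have := hy.2
    rw [Metric.mem_ball, Subtype.dist_eq] at this ⊢
    exact (Real.dist_right_le_of_mem_uIcc hs).trans_lt this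
  rw [h1]
  have hball : Disjoint (Metric.ball z.1 r) (frontier (B z.2)) :=
    Set.disjoint_left.2 fun x hx =>
      hsub (show (x, z.2) ∈ _ from ⟨hx, Metric.mem_ball_self hr⟩)
  have hpre : IsPreconnected (Metric.ball z.1 r) := (convex_ball _ _).isPreconnected
  have hz' : z.1 ∈ Metric.ball z.1 r := Metric.mem_ball_self hr
  have hBo := h.isOpen _ z.2.2
  exact ⟨fun hB => subset_of_disjoint_frontier hpre hBo hball ⟨_, hy.1, hB⟩ hz',
    fun hB => subset_of_disjoint_frontier hpre hBo hball ⟨_, hz', hB⟩ hy.1⟩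

lemma IsComparisonFlow.isOpen_spacetime (h : IsComparisonFlow Ω a b B) :
    IsOpen {z : Space m × Icc a b | z.1 ∈ B z.2} := by
  rw [isOpen_iff_mem_nhds]
  intro z hz
  have hz' : z.1 ∈ B z.2 := hz
  have : z.1 ∉ frontier (B z.2) := by
    rw [(h.isOpen _ z.2.2).frontier_eq]
    exact fun h => h.2 hz'
  filter_upwards [h.eventually_mem_iff this] with y hy using hy.2 hz'

lemma IsComparisonFlow.isClosed_spacetime (h : IsComparisonFlow Ω a b B) :
    IsClosed {z : Space m × Icc a b | z.1 ∈ closure (B z.2)} := by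
  rw [← isOpen_compl_iff, isOpen_iff_mem_nhds]
  intro z hz
  have hz' : z.1 ∉ closure (B z.2) := hz
  have hev := h.eventually_mem_iff (z := z) fun h => hz' h.1
  filter_upwards [eventually_eventually_nhds.2 hev] with y hy hcl
  have hcl' : y.1 ∈ closure (B y.2) := hcl
  have hy' : ∀ᶠ x in 𝓝 y.1, (x ∈ B y.2 ↔ z.1 ∈ B z.2) :=
    (Continuous.prodMk_left y.2).continuousAt.eventually hy
  obtain ⟨x, hxB, hx⟩ := (mem_closure_iff_frequently.1 hcl').and_eventually hy' |>.exists
  exact hz' (subset_closure (hx.1 hxB))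

/-- A nonempty bounded open set of a Euclidean space of positive dimension has a boundary
point. -/
lemma frontier_nonempty_of_isCompact_closure {U : Set (Space m)} (hne : U.Nonempty)
    (hc : IsCompact (closure U)) : (frontier U).Nonempty := by
  rw [nonempty_frontier_iff]
  refine ⟨hne, ?_⟩
  rintro rfl
  rw [closure_univ] at hc
  exact noncompact_univ _ hc

/-- The avoidance principle for comparison flows. -/
theorem IsComparisonFlow.disjoint (hB : IsComparisonFlow Ω a b B) (hC : IsComparisonFlow Ω a b C)
    (hab : a ≤ b) (h0 : Disjoint (closure (B a)) (closure (C a))) :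
    Disjoint (B b) (C b) := by
  have hfr : ∀ t ∈ Icc a b, Disjoint (frontier (B t)) (frontier (C t)) := fun t ht =>
    hB.flow.disjoint hC.flow (h0.mono frontier_subset_closure frontier_subset_closure) ht
  have hmeet : ∀ t ∈ Icc a b, ∀ x, x ∈ closure (B t) → x ∈ closure (C t) →
      (B t ∩ C t).Nonempty := by
    intro t ht x hxB hxC
    by_cases hx : x ∈ B t
    · exact mem_closure_iff.1 hxC _ (hB.isOpen t ht) hx
    · have hx' : x ∈ C t := by
        by_contra hn
        have hd : x ∉ frontier (C t) := Set.disjoint_left.1 (hfr t ht) <| by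
          rw [(hB.isOpen t ht).frontier_eq]; exact ⟨hxB, hx⟩
        rw [(hC.isOpen t ht).frontier_eq] at hd
        exact hd ⟨hxC, hn⟩
      rw [inter_comm]
      exact mem_closure_iff.1 hxB _ (hC.isOpen t ht) hx'
  -- The set of times at which the two regions overlap is clopen, so an overlap at time `b` would
  -- force one at time `a`.
  let K : Set (Icc a b) := {t | (B t ∩ C t).Nonempty}
  have hKo : IsOpen K := by
    have : K = Prod.snd '' ({z : Space m × Icc a b | z.1 ∈ B z.2} ∩ {z | z.1 ∈ C z.2}) := by
      ext t
      constructor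
      · rintro ⟨x, hx⟩
        exact ⟨(x, t), hx, rfl⟩
      · rintro ⟨⟨x, s⟩, hx, rfl⟩
        exact ⟨x, hx⟩
    rw [this]
    exact isOpenMap_snd _ (hB.isOpen_spacetime.inter hC.isOpen_spacetime)
  have hKc : IsClosed K := by
    have : K = Prod.snd '' (({z : Space m × Icc a b | z.1 ∈ frontier (B z.2)} ∪
        {z | z.1 ∈ frontier (C z.2)}) ∩
        ({z | z.1 ∈ closure (B z.2)} ∩ {z | z.1 ∈ closure (C z.2)})) := by
      ext t
      constructor
      · intro ht
        -- An overlap has a boundary point, which lies on one of the two moving boundaries. Their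
        -- tracks are compact, so the projection to time is closed.
        obtain ⟨x, hx⟩ := frontier_nonempty_of_isCompact_closure ht
          ((hB.isCompact_closure t t.2).of_isClosed_subset isClosed_closure
            (closure_mono inter_subset_left))
        refine ⟨(x, t), ⟨?_, closure_mono inter_subset_left hx.1,
          closure_mono inter_subset_right hx.1⟩, rfl⟩
        rcases frontier_inter_subset _ _ hx with h | h
        · exact Or.inl h.1
        · exact Or.inr h.2
      · rintro ⟨⟨x, s⟩, ⟨-, hxB, hxC⟩, rfl⟩
        exact hmeet s s.2 x hxB hxC
    rw [this]
    exact (((hB.flow.isCompact_track.union hC.flow.isCompact_track).inter_right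
      (hB.isClosed_spacetime.inter hC.isClosed_spacetime)).image continuous_snd).isClosed
  have : PreconnectedSpace (Icc a b) := Subtype.preconnectedSpace isPreconnected_Icc
  rw [Set.disjoint_iff_inter_eq_empty, ← not_nonempty_iff_eq_empty]
  intro hne
  have hK : K = univ := IsClopen.eq_univ ⟨hKc, hKo⟩ ⟨⟨b, hab, le_rfl⟩, hne⟩
  obtain ⟨x, hx⟩ : (⟨a, le_rfl, hab⟩ : Icc a b) ∈ K := hK ▸ mem_univ _
  exact Set.disjoint_left.1 h0 (subset_closure hx.1) (subset_closure hx.2)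

end Avoidance

/-! ### The smallest supersolution -/

section Minimal

variable {m : ℕ} {Ω A : Set (Space m)}

/-- The relative interior of the intersection of all supersolutions that contain `A` initially. -/
def minimalSupersolution (Ω A : Set (Space m)) (t : ℝ) : Set (Space m) :=
  -- The premise `x ∈ closure Ω` admits all points outside `closure Ω`, so the ambient interior
  -- yields the relative one after intersecting.
  interior {x | ∀ At : ℝ → Set (Space m), IsSupersolution Ω At → A ⊆ At 0 →
    x ∈ closure Ω → x ∈ At t} ∩ closure Ω

lemma minimalSupersolution_subset {At : ℝ → Set (Space m)} (h : IsSupersolution Ω At)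
    (hA : A ⊆ At 0) (t : ℝ) : minimalSupersolution Ω A t ⊆ At t :=
  fun _ hx => interior_subset hx.1 At h hA hx.2

lemma isOpenIn_minimalSupersolution (Ω A : Set (Space m)) (t : ℝ) :
    IsOpenIn Ω (minimalSupersolution Ω A t) :=
  ⟨_, isOpen_interior, rfl⟩

lemma isSupersolution_minimalSupersolution (Ω A : Set (Space m)) :
    IsSupersolution Ω (minimalSupersolution Ω A) := by
  refine ⟨fun t _ => isOpenIn_minimalSupersolution Ω A t, fun a b B ha hab hB hsub => ?_⟩
  have hb : b ∈ Icc a b := ⟨hab, le_rfl⟩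
  refine subset_inter (interior_maximal ?_ (hB.isOpen b hb)) ?_
  · intro x hx At hAt hA _
    exact hAt.2 a b B ha hab hB (hsub.trans (minimalSupersolution_subset hAt hA a)) hx
  · exact subset_closure.trans ((hB.closure_subset b hb).trans subset_closure)

lemma subset_minimalSupersolution_zero (hA : IsOpen A) (hAΩ : A ⊆ Ω) :
    A ⊆ minimalSupersolution Ω A 0 :=
  subset_inter (interior_maximal (fun _ hx _ _ h _ => h hx) hA) (hAΩ.trans subset_closure)

lemma minimalSupersolution_zero (hA : IsOpen A) (hAΩ : A ⊆ Ω) :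
    minimalSupersolution Ω A 0 = A := by
  refine Subset.antisymm ?_ (subset_minimalSupersolution_zero hA hAΩ)
  -- The largest competitor that equals `A` at time `0`: it jumps to all of `closure Ω` at once. A
  -- comparison with `b = 0` has `a = 0` and is trivial.
  have h : IsSupersolution Ω (fun t : ℝ => if t = 0 then A else closure Ω) := by
    refine ⟨fun t _ => ?_, fun a b B ha hab hB hsub => ?_⟩
    · dsimp only
      split_ifs
      · exact ⟨A, hA, (inter_eq_left.2 (hAΩ.trans subset_closure)).symm⟩
      · exact ⟨univ, isOpen_univ, (univ_inter _).symm⟩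
    · dsimp only at hsub ⊢
      split_ifs with hb
      · obtain rfl : a = b := by linarith
        rw [if_pos hb] at hsub
        exact subset_closure.trans hsub
      · exact subset_closure.trans ((hB.closure_subset b ⟨hab, le_rfl⟩).trans subset_closure)
  simpa using minimalSupersolution_subset (A := A) h (by simp) 0

/-- Removing a comparison flow whose initial closure is disjoint from the closure of a
supersolution leaves a supersolution. -/
lemma IsSupersolution.diff_comparisonFlow {At : ℝ → Set (Space m)} (h : IsSupersolution Ω At)
    {a b : ℝ} {B : ℝ → Set (Space m)} (hB : IsComparisonFlow Ω a b B)
    (h0 : Disjoint (closure (B a)) (closure (At a))) :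
    IsSupersolution Ω (fun t => {x ∈ At t | t ∈ Icc a b → x ∉ closure (B t)}) := by
  refine ⟨fun t ht => ?_, fun c d C hc hcd hC hsub => ?_⟩
  · obtain ⟨U, hU, hAU⟩ := h.1 t ht
    by_cases htab : t ∈ Icc a b
    · refine ⟨U \ closure (B t), hU.sdiff isClosed_closure, ?_⟩
      ext x
      simp [hAU, htab.1, htab.2]
      tauto
    · refine ⟨U, hU, ?_⟩
      rw [← hAU]
      ext x
      exact ⟨fun hx => hx.1, fun hx => ⟨hx, fun h => absurd h htab⟩⟩
  · have hCA : closure (C c) ⊆ At c := fun x hx => (hsub hx).1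
    refine fun x hx => ⟨h.2 c d C hc hcd hC hCA hx, fun hd hxB => ?_⟩
    have hmeet : (B d ∩ C d).Nonempty := by
      rw [inter_comm]
      exact mem_closure_iff.1 hxB _ (hC.isOpen d ⟨hcd, le_rfl⟩) hx
    -- Run avoidance from the later of the two starting times. If `B` starts first, the closures are
    -- disjoint at time `c` by construction; otherwise `C` stays in `At` up to time `a`, where `h0`
    -- applies.
    rcases le_total a c with hac | hca
    · have hdisj : Disjoint (closure (B c)) (closure (C c)) :=
        Set.disjoint_right.2 fun y hy => (hsub hy).2 ⟨hac, hcd.trans hd.2⟩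
      exact not_disjoint_iff_nonempty_inter.2 hmeet
        ((hB.mono (Icc_subset_Icc hac hd.2)).disjoint hC hcd hdisj)
    · have hCa : C a ⊆ At a := h.2 c a C hc hca (hC.mono (Icc_subset_Icc_right hd.1)) hCA
      exact not_disjoint_iff_nonempty_inter.2 hmeet
        ((hB.mono (Icc_subset_Icc_right hd.2)).disjoint (hC.mono (Icc_subset_Icc_left hca)) hd.1
          (h0.mono_right (closure_mono hCa)))

/-- Minimality puts the solution inside its own copy with the comparison flow removed, so it misses
`closure (B b)`; as `B b` is open, so does its closure miss `B b`. -/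
lemma isSubsolution_minimalSupersolution (hA : IsOpen A) (hAΩ : A ⊆ Ω) :
    IsSubsolution Ω (minimalSupersolution Ω A) := by
  refine ⟨fun t _ => isOpenIn_minimalSupersolution Ω A t, fun t _ =>
    ⟨_, isClosed_closure.isOpen_compl, (sdiff_eq _ _).trans (inter_comm _ _)⟩,
    fun a b B ha hab hB hsub => ?_⟩
  have hb : b ∈ Icc a b := ⟨hab, le_rfl⟩
  have h0 : Disjoint (closure (B a)) (closure (minimalSupersolution Ω A a)) :=
    Set.disjoint_left.2 fun x hx => (hsub hx).2
  have hsup := (isSupersolution_minimalSupersolution Ω A).diff_comparisonFlow hB h0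
  -- The removal touches time `0` only if `a = 0`, and then `h0` shows that no point of `A` is lost.
  have hmin := minimalSupersolution_subset (A := A) hsup (fun x hx => by
    have hx' := subset_minimalSupersolution_zero hA hAΩ hx
    refine ⟨hx', fun h hxB => ?_⟩
    obtain rfl : a = 0 := le_antisymm h.1 ha
    exact Set.disjoint_left.1 h0 hxB (subset_closure hx')) b
  intro x hx
  refine ⟨subset_closure (hB.closure_subset b hb (subset_closure hx)), fun hcl => ?_⟩
  obtain ⟨y, hyB, hy⟩ := mem_closure_iff.1 hcl _ (hB.isOpen b hb) hx
  exact (hmin hy).2 hb (subset_closure hyB)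

end Minimal

end ShadowFlow

theorem mainTheorem5 {m : ℕ} (Ω : Set (ShadowFlow.Space m)) (hΩ : IsOpen Ω)
    (A : Set (ShadowFlow.Space m)) (hA : IsOpen A) (hAΩ : A ⊆ Ω) :
    ∃ At : ℝ → Set (ShadowFlow.Space m),
      ShadowFlow.IsWeakSolution Ω At ∧ At 0 = A ∧
        ∀ At' : ℝ → Set (ShadowFlow.Space m), ShadowFlow.IsWeakSolution Ω At' → A ⊆ At' 0 →
          ∀ t, 0 ≤ t → At t ⊆ At' t :=
  ⟨ShadowFlow.minimalSupersolution Ω A,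
    ⟨ShadowFlow.isSupersolution_minimalSupersolution Ω A,
      ShadowFlow.isSubsolution_minimalSupersolution hA hAΩ⟩,
    ShadowFlow.minimalSupersolution_zero hA hAΩ,
    fun _ h hA' t _ => ShadowFlow.minimalSupersolution_subset h.1 hA' t⟩
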